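/- Let $\alpha,\beta\in\mathbb C$ with $\beta\neq 0$, let $h(z)=e^z+\beta z+\alpha$, and let $$N_h(z)=z-\frac{h(z)}{h'(z)}=\frac{z-1-\alpha e^{-z}}{1+\beta e^{-z}}$$ be its Newton's method, regarded as a meromorphic map $N_h:\mathbb C\to\widehat{\mathbb C}$ (with a removable singularity filled in). Put $u=-\alpha/\beta$, the asymptotic value of $N_h$. For a transcendental meromorphic $f:\mathbb C\to\widehat{\mathbb C}$, the Fatou set is the set of points having a neighbourhood on which all iterates $f^n$ are defined and form a normal family, and the Julia set $J(f)$ is its complement in $\widehat{\mathbb C}$. Let $S(f)\subset\mathbb C$ be the set of finite critical and asymptotic values of $f$, and let $P(f)=\mathbb C\cap\bigcup_{s\in\overline{S(f)}}\bigcup_{n\ge 0}f^n(s)$ be the postsingular set, where terms that are undefined or infinite are neglected. The map $f$ is called topologically hyperbolic if $\operatorname{dist}(P(f),J(f)\cap\mathbb C)>0$, where $\operatorname{dist}$ is the Euclidean distance. Then: 1. If $\inf_{n\ge 0}\operatorname{dist}(N_h^n(u),J(N_h)\cap\mathbb C)>0$, then $N_h$ is a transcendental meromorphic function and is topologically hyperbolic.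 2. There is $r>0$ such that, for every superattracting fixed point $c$ of $N_h$ (that is, $N_h(c)=c$ and $N_h'(c)=0$), the map $N_h$ has no pole in $\mathbb D(c,r)=\{z\in\mathbb C:|z-c|<r\}$ and $|N_h'(z)|<1$ for every $z\in\mathbb D(c,r)$. -/

import Mathlib

open scoped OnePoint Topology

noncomputable section

namespace MeroDyn

/-- The finite part of a map into the Riemann sphere `OnePoint ℂ`: `f z` where `f z` is finite,
and `0` where `f z = ∞`. -/
def finitePart (f : ℂ → OnePoint ℂ) (z : ℂ) : ℂ :=
  (f z).elim 0 id

/-- The chordal metric on the Riemann sphere. -/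
def chordalDist : OnePoint ℂ → OnePoint ℂ → ℝ
  | OnePoint.infty, OnePoint.infty => 0
  | OnePoint.infty, OnePoint.some w => 2 / √(1 + ‖w‖ ^ 2)
  | OnePoint.some z, OnePoint.infty => 2 / √(1 + ‖z‖ ^ 2)
  | OnePoint.some z, OnePoint.some w => 2 * ‖z - w‖ / (√(1 + ‖z‖ ^ 2) * √(1 + ‖w‖ ^ 2))

/-- `f : ℂ → OnePoint ℂ` is a transcendental meromorphic function: it is continuous as a map into
the sphere and meromorphic at every point, and it has an essential singularity at infinity, i.e.
`f z` has no limit in the sphere as `z → ∞` (this also excludes the constant map `∞`). -/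
structure IsTranscendentalMeromorphic (f : ℂ → OnePoint ℂ) : Prop where
  continuous : Continuous f
  meromorphic : ∀ z, MeromorphicAt (finitePart f) z
  essential : ¬ ∃ l : OnePoint ℂ, Filter.Tendsto f (Filter.cocompact ℂ) (𝓝 l)

/-- The iterate `fⁿ(z)`. It is undefined once an earlier iterate is `∞`; in that case the
value used here is `∞`, so that the value is a finite number only where `fⁿ(z)` is defined and
finite. -/
def iter (f : ℂ → OnePoint ℂ) (n : ℕ) (z : ℂ) : OnePoint ℂ :=
  (fun x : OnePoint ℂ => x.elim ∞ f)^[n] (z : OnePoint ℂ)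

/-- The set of all finite points `fⁿ(z)`, `n ≥ 0`. -/
def orbit (f : ℂ → OnePoint ℂ) (z : ℂ) : Set ℂ :=
  {w | ∃ n : ℕ, iter f n z = (w : OnePoint ℂ)}

/-- A sequence of maps into the sphere is a normal family on `U`: every sequence of its members has
a subsequence that converges, in the chordal metric, uniformly on compact subsets of `U`. -/
def IsNormalOn (F : ℕ → ℂ → OnePoint ℂ) (U : Set ℂ) : Prop :=
  ∀ m : ℕ → ℕ, ∃ φ : ℕ → ℕ, StrictMono φ ∧ ∃ g : ℂ → OnePoint ℂ,
    ∀ K ⊆ U, IsCompact K → ∀ ε > 0, ∀ᶠ k in Filter.atTop,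
      ∀ z ∈ K, chordalDist (F (m (φ k)) z) (g z) < ε

/-- The Fatou set of a transcendental meromorphic function: the points with a neighbourhood on
which all iterates are defined and form a normal family. (All iterates are defined at `w`
exactly when none of them is `∞` there; the point `∞` never belongs to the Fatou set.) -/
def fatouSet (f : ℂ → OnePoint ℂ) : Set (OnePoint ℂ) :=
  (↑) '' {z : ℂ | ∃ U : Set ℂ, IsOpen U ∧ z ∈ U ∧
    (∀ n, ∀ w ∈ U, iter f n w ≠ ∞) ∧ IsNormalOn (iter f) U}

/-- The Julia set, a subset of the sphere. -/
def juliaSet (f : ℂ → OnePoint ℂ) : Set (OnePoint ℂ) := (fatouSet f)ᶜ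

/-- The finite part `J(f) ∩ ℂ` of the Julia set. -/
def finiteJuliaSet (f : ℂ → OnePoint ℂ) : Set ℂ := {z : ℂ | (z : OnePoint ℂ) ∈ juliaSet f}

/-- `a ∈ ℂ` is a finite critical value of `f`. -/
def IsCriticalValue (f : ℂ → OnePoint ℂ) (a : ℂ) : Prop :=
  ∃ z : ℂ, f z = (a : OnePoint ℂ) ∧ HasDerivAt (finitePart f) 0 z

/-- `a ∈ ℂ` is a finite asymptotic value of `f`: there is a curve tending to `∞` along which
`f` tends to `a`. -/
def IsAsymptoticValue (f : ℂ → OnePoint ℂ) (a : ℂ) : Prop :=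
  ∃ γ : ℝ → ℂ, ContinuousOn γ (Set.Ici 0) ∧
    Filter.Tendsto γ Filter.atTop (Filter.cocompact ℂ) ∧
    Filter.Tendsto (fun t => f (γ t)) Filter.atTop (𝓝 (a : OnePoint ℂ))

/-- The set `S(f)` of finite singular values. -/
def singularValues (f : ℂ → OnePoint ℂ) : Set ℂ :=
  {a | IsCriticalValue f a ∨ IsAsymptoticValue f a}

/-- The postsingular set `P(f)`: all finite points of forward orbits of points in the closure of
`S(f)`. -/
def postsingularSet (f : ℂ → OnePoint ℂ) : Set ℂ :=
  ⋃ s ∈ closure (singularValues f), orbit f s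

/-- The Euclidean distance `inf {|z - w| : z ∈ A, w ∈ B}`, with value `⊤` if `A` or `B` is empty. -/
def setDist (A B : Set ℂ) : ENNReal := ⨅ z ∈ A, ⨅ w ∈ B, edist z w

/-- Topological hyperbolicity: `f` is transcendental meromorphic and
`dist (P(f), J(f) ∩ ℂ) > 0`. -/
def IsTopologicallyHyperbolic (f : ℂ → OnePoint ℂ) : Prop :=
  IsTranscendentalMeromorphic f ∧ 0 < setDist (postsingularSet f) (finiteJuliaSet f)

/-- `c` is a superattracting fixed point of `f`. -/
def IsSuperattractingFixedPoint (f : ℂ → OnePoint ℂ) (c : ℂ) : Prop :=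
  f c = (c : OnePoint ℂ) ∧ HasDerivAt (finitePart f) 0 c

open Classical in
/-- Newton's method `z - h z / h' z` of a nonconstant entire function `h`, as a map into the sphere.
At a common zero `z` of `h` and `h'` the quotient `h / h'` has a removable singularity with value
`0`, so that Newton's method takes the value `z` there (in Lean `0 / 0 = 0`); at the other zeros of
`h'` it has a pole. -/
def newton (h : ℂ → ℂ) (z : ℂ) : OnePoint ℂ :=
  if deriv h z = 0 ∧ h z ≠ 0 then ∞ else ((z - h z / deriv h z : ℂ) : OnePoint ℂ)

end MeroDyn

end

open scoped OnePoint Topology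

namespace MeroDyn

open Filter Set

/-! ### Contracting fixed points, the Fatou set and distances -/

section General

variable {f : ℂ → OnePoint ℂ} {c z : ℂ} {r : ℝ}

/-! Write `N` for the Newton map of `h`. Since `N' = h h'' / h'^2` and `h'' = exp` has no zeros,
critical points of `N` are simple zeros of `h`, hence superattracting fixed points; at a double zero
`N' = 1/2`.

The key is uniformity over these infinitely many points. If `h c = 0`, then `h' c = β (1 - α/β -
c)`, which vanishes only at one fixed point of the plane. Zeros of `h` are isolated, so all simple
zeros stay away from it; this gives `δ (1 + ‖exp c‖) ≤ ‖h' c‖`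
(`exists_lower_bound_deriv_at_zeros`). On a small disc of radius `r` about `c`, both `h` and `exp`
are `O(1 + ‖exp c‖)`, the former with a factor `r`, so `‖N'‖ ≤ 1/2` for a common `r`
(`exists_radius_of_lower_bound`). This is the second claim, and it puts all these discs in the Fatou
set.

For the first claim, the only possible finite asymptotic value is `u = -α/β`: a limit `a ≠ u` along
a curve would give `exp (-z) / z` a nonzero limit, which the rotation of `exp (-z)` forbids
(`eq_zero_of_tendsto_exp_neg_div`). So the postsingular set consists of the orbit of `u`, handled by
hypothesis, and of fixed points centred in Fatou discs of radius `r`. -/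

theorem finitePart_of_eq {w : ℂ} (h : f z = (w : OnePoint ℂ)) : finitePart f z = w := by
  simp [finitePart, h]

theorem coe_finitePart (h : f z ≠ ∞) : (finitePart f z : OnePoint ℂ) = f z := by
  obtain ⟨w, hw⟩ := OnePoint.ne_infty_iff_exists.1 h
  rw [finitePart_of_eq hw.symm, hw]

theorem tendsto_finitePart {ι : Type*} {l : Filter ι} {γ : ι → ℂ} {a : ℂ}
    (h : Tendsto (fun t => f (γ t)) l (𝓝 (a : OnePoint ℂ))) :
    (∀ᶠ t in l, f (γ t) ≠ ∞) ∧ Tendsto (fun t => finitePart f (γ t)) l (𝓝 a) := by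
  refine ⟨h.eventually_ne (OnePoint.coe_ne_infty a), ?_⟩
  have hc : ContinuousAt (fun x : OnePoint ℂ => x.elim 0 (id : ℂ → ℂ)) (a : OnePoint ℂ) :=
    OnePoint.continuousAt_coe.2 continuousAt_id
  exact hc.tendsto.comp h

theorem chordalDist_coe_le (z w : ℂ) :
    chordalDist (z : OnePoint ℂ) (w : OnePoint ℂ) ≤ 2 * ‖z - w‖ := by
  have h1 : ∀ x : ℂ, 1 ≤ √(1 + ‖x‖ ^ 2) := fun x => by
    rw [Real.one_le_sqrt]; nlinarith [sq_nonneg ‖x‖]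
  change 2 * ‖z - w‖ / (√(1 + ‖z‖ ^ 2) * √(1 + ‖w‖ ^ 2)) ≤ 2 * ‖z - w‖
  exact div_le_self (by positivity) (one_le_mul_of_one_le_of_one_le (h1 z) (h1 w))

theorem iter_succ (f : ℂ → OnePoint ℂ) (n : ℕ) (z : ℂ) :
    iter f (n + 1) z = (iter f n z).elim ∞ f := by
  simp [iter, Function.iterate_succ_apply']

theorem iter_of_fixed (h : f z = (z : OnePoint ℂ)) (n : ℕ) : iter f n z = (z : OnePoint ℂ) := by
  induction n with
  | zero => rfl
  | succ n ih => rw [iter_succ, ih]; simpa using h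

theorem orbit_of_fixed (h : f z = (z : OnePoint ℂ)) : orbit f z = {z} := by
  ext w
  simp [orbit, iter_of_fixed h, eq_comm]

/-- A sequence of natural numbers has a subsequence that is constant or tends to infinity. -/
theorem exists_subseq_const_or_tendsto (m : ℕ → ℕ) :
    ∃ φ : ℕ → ℕ, StrictMono φ ∧ ((∃ N, ∀ k, m (φ k) = N) ∨ Tendsto (m ∘ φ) atTop atTop) := by
  by_cases h : ∃ N, ∃ᶠ k in atTop, m k = N
  · obtain ⟨N, hN⟩ := h
    obtain ⟨φ, hφ, hφN⟩ := extraction_of_frequently_atTop hN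
    exact ⟨φ, hφ, Or.inl ⟨N, hφN⟩⟩
  · push Not at h
    refine ⟨id, strictMono_id, Or.inr ?_⟩
    rw [Function.comp_id, tendsto_atTop]
    intro b
    have : ∀ᶠ k in atTop, ∀ N ∈ Finset.range b, m k ≠ N :=
      (eventually_all_finset _).2 fun N _ => by simpa using h N
    filter_upwards [this] with k hk
    by_contra hlt
    exact hk (m k) (Finset.mem_range.2 (not_le.1 hlt)) rfl

/-- The mean value inequality on the convex disc halves the distance to `c` at each step, so the
orbit never leaves the disc. -/
theorem exists_iter_eq_of_contracting (hfc : f c = (c : OnePoint ℂ))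
    (hf : ∀ z ∈ Metric.ball c r, f z ≠ ∞ ∧
      ∃ d : ℂ, HasDerivAt (finitePart f) d z ∧ ‖d‖ ≤ 1 / 2)
    (hz : z ∈ Metric.ball c r) (n : ℕ) :
    ∃ v : ℂ, iter f n z = (v : OnePoint ℂ) ∧ ‖v - c‖ ≤ (1 / 2) ^ n * ‖z - c‖ := by
  choose! hinf d hd hd2 using hf
  induction n with
  | zero => exact ⟨z, rfl, by simp⟩
  | succ n ih =>
    obtain ⟨v, hv, hvc⟩ := ih
    rw [mem_ball_iff_norm] at hz
    have hvr : v ∈ Metric.ball c r := by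
      rw [mem_ball_iff_norm]
      refine (hvc.trans (mul_le_of_le_one_left (norm_nonneg _) ?_)).trans_lt hz
      exact pow_le_one₀ (by norm_num) (by norm_num)
    have hcr : c ∈ Metric.ball c r := Metric.mem_ball_self ((norm_nonneg _).trans_lt hz)
    refine ⟨finitePart f v, ?_, ?_⟩
    · rw [iter_succ, hv, coe_finitePart (hinf v hvr)]; rfl
    · have := (convex_ball c r).norm_image_sub_le_of_norm_hasDerivWithin_le
        (fun x hx => (hd x hx).hasDerivWithinAt) hd2 hcr hvr
      rw [finitePart_of_eq hfc] at this
      rw [pow_succ']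
      linarith

/-- A disc around a fixed point on which the derivative is at most `1 / 2` lies in the Fatou
set. -/
theorem mem_fatouSet_of_contracting (hfc : f c = (c : OnePoint ℂ))
    (hf : ∀ z ∈ Metric.ball c r, f z ≠ ∞ ∧
      ∃ d : ℂ, HasDerivAt (finitePart f) d z ∧ ‖d‖ ≤ 1 / 2)
    (hz : z ∈ Metric.ball c r) : (z : OnePoint ℂ) ∈ fatouSet f := by
  have hit := fun (w : ℂ) (hw : w ∈ Metric.ball c r) (n : ℕ) =>
    exists_iter_eq_of_contracting hfc hf hw n
  refine ⟨z, ⟨Metric.ball c r, Metric.isOpen_ball, hz, ?_, ?_⟩, rfl⟩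
  · intro n w hw
    obtain ⟨v, hv, -⟩ := hit w hw n
    rw [hv]; exact OnePoint.coe_ne_infty v
  · intro m
    obtain ⟨φ, hφ, ⟨N, hN⟩ | hm⟩ := exists_subseq_const_or_tendsto m
    · refine ⟨φ, hφ, iter f N, fun K hK _ ε hε => Eventually.of_forall fun k w hw => ?_⟩
      obtain ⟨v, hv, -⟩ := hit w (hK hw) N
      rw [hN, hv]
      exact (chordalDist_coe_le v v).trans_lt (by simpa using hε)
    · refine ⟨φ, hφ, fun _ => (c : OnePoint ℂ), fun K hK _ ε hε => ?_⟩
      have hlim : Tendsto (fun k => 2 * ((1 / 2 : ℝ) ^ (m (φ k)) * r)) atTop (𝓝 (2 * (0 * r))) :=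
        (((tendsto_pow_atTop_nhds_zero_of_lt_one (by norm_num) (by norm_num)).comp
          hm).mul_const r).const_mul 2
      rw [zero_mul, mul_zero] at hlim
      filter_upwards [hlim.eventually_lt_const hε] with k hk w hw
      obtain ⟨v, hv, hvc⟩ := hit w (hK hw) (m (φ k))
      have hwr := mem_ball_iff_norm.1 (hK hw)
      rw [hv]
      refine ((chordalDist_coe_le v c).trans ?_).trans_lt hk
      have : (1 / 2 : ℝ) ^ m (φ k) * ‖w - c‖ ≤ (1 / 2) ^ m (φ k) * r :=
        mul_le_mul_of_nonneg_left hwr.le (by positivity)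
      linarith

theorem setDist_union_left (A A' B : Set ℂ) :
    setDist (A ∪ A') B = min (setDist A B) (setDist A' B) :=
  iInf_union

theorem setDist_anti_left {A A' B : Set ℂ} (h : A ⊆ A') : setDist A' B ≤ setDist A B :=
  iInf_le_iInf_of_subset h

end General

/-! ### Newton's method of an entire function -/

section Newton

variable {h : ℂ → ℂ} {z : ℂ}

theorem newton_of_deriv_ne_zero (hz : deriv h z ≠ 0) :
    newton h z = ((z - h z / deriv h z : ℂ) : OnePoint ℂ) := by
  simp [newton, hz]

theorem newton_of_eq_zero (hz : h z = 0) : newton h z = (z : OnePoint ℂ) := by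
  simp [newton, hz]

theorem newton_of_pole (hz : deriv h z = 0) (hz' : h z ≠ 0) : newton h z = ∞ := by
  simp [newton, hz, hz']

theorem newton_eventually_eq (hh : Differentiable ℂ h) (hz : deriv h z ≠ 0) :
    newton h =ᶠ[𝓝 z] fun w => ((w - h w / deriv h w : ℂ) : OnePoint ℂ) := by
  have hc : ContinuousAt (deriv h) z := hh.deriv.continuous.continuousAt
  filter_upwards [hc.eventually_ne hz] with w hw
  exact newton_of_deriv_ne_zero hw

theorem hasDerivAt_finitePart_newton (hh : Differentiable ℂ h) (hz : deriv h z ≠ 0) :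
    HasDerivAt (finitePart (newton h)) (h z * deriv (deriv h) z / deriv h z ^ 2) z := by
  have h1 := (hasDerivAt_id z).sub
    ((hh z).hasDerivAt.div (hh.deriv z).hasDerivAt hz)
  refine (h1.congr_deriv ?_).congr_of_eventuallyEq ?_
  · field_simp; ring
  · filter_upwards [newton_eventually_eq hh hz] with w hw
    simp [finitePart_of_eq hw]

theorem continuousAt_newton (hh : Differentiable ℂ h) (hz : deriv h z ≠ 0) :
    ContinuousAt (newton h) z := by
  refine ContinuousAt.congr ?_ (newton_eventually_eq hh hz).symm
  exact OnePoint.continuous_coe.continuousAt.comp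
    (continuousAt_id.sub (hh.continuous.continuousAt.div hh.deriv.continuous.continuousAt hz))

theorem continuousAt_newton_of_pole (hh : Differentiable ℂ h) (hz : deriv h z = 0)
    (hz' : h z ≠ 0) (hne : ∀ᶠ w in 𝓝[≠] z, deriv h w ≠ 0) : ContinuousAt (newton h) z := by
  rw [continuousAt_iff_punctured_nhds, newton_of_pole hz hz']
  have hev : (fun w => ((w - h w / deriv h w : ℂ) : OnePoint ℂ)) =ᶠ[𝓝[≠] z] newton h := by
    filter_upwards [hne] with w hw using (newton_of_deriv_ne_zero hw).symm
  refine Tendsto.congr' hev ?_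
  have hco : Tendsto (fun w : ℂ => (w : OnePoint ℂ)) (Bornology.cobounded ℂ) (𝓝 ∞) := by
    rw [Metric.cobounded_eq_cocompact, ← coclosedCompact_eq_cocompact]
    exact OnePoint.tendsto_coe_infty
  refine hco.comp ?_
  have hd : Tendsto (deriv h) (𝓝[≠] z) (𝓝[≠] 0) := by
    refine tendsto_nhdsWithin_iff.2 ⟨?_, by simpa using hne⟩
    rw [← hz]
    exact hh.deriv.continuous.continuousAt.mono_left nhdsWithin_le_nhds
  have hinv : Tendsto (fun w => (deriv h w)⁻¹) (𝓝[≠] z) (Bornology.cobounded ℂ) :=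
    tendsto_inv₀_nhdsNE_zero.comp hd
  have hcont : Tendsto h (𝓝[≠] z) (𝓝 (h z)) :=
    hh.continuous.continuousAt.mono_left nhdsWithin_le_nhds
  have hid : Tendsto (fun w : ℂ => w) (𝓝[≠] z) (𝓝 z) := nhdsWithin_le_nhds
  rw [← tendsto_norm_atTop_iff_cobounded] at hinv ⊢
  have hq : Tendsto (fun w => ‖h w‖ * ‖(deriv h w)⁻¹‖ - ‖w‖) (𝓝[≠] z) atTop :=
    (hcont.norm.pos_mul_atTop (norm_pos_iff.2 hz') hinv).atTop_add hid.norm.neg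
  refine tendsto_atTop_mono (fun w => ?_) hq
  rw [← norm_mul, ← div_eq_mul_inv, norm_sub_rev w]
  exact norm_sub_norm_le _ _

end Newton

/-! ### Limits of exponentials, in particular along curves to infinity -/

theorem tendsto_exp_sub_one_sub_id_div_sq :
    Tendsto (fun t : ℂ => (Complex.exp t - 1 - t) / t ^ 2) (𝓝[≠] 0) (𝓝 (1 / 2)) := by
  have h1 := ((Complex.exp_sub_sum_range_succ_isLittleO_pow 2).tendsto_div_nhds_zero.mono_left
    (nhdsWithin_le_nhds (s := {0}ᶜ))).add_const (1 / 2)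
  rw [zero_add] at h1
  refine h1.congr' ?_
  filter_upwards [self_mem_nhdsWithin] with t ht
  have ht : t ≠ 0 := ht
  simp only [Finset.sum_range_succ, Finset.sum_range_zero, Nat.factorial]
  push_cast
  field_simp
  ring

theorem tendsto_exp_sub_one_div_id :
    Tendsto (fun t : ℂ => (Complex.exp t - 1) / t) (𝓝[≠] 0) (𝓝 1) := by
  have h1 := hasDerivAt_iff_tendsto_slope.1 (Complex.hasDerivAt_exp 0)
  rw [Complex.exp_zero] at h1
  refine h1.congr fun t => ?_
  simp [slope_def_field]

/-- A continuous real function on a half-line whose absolute value tends to infinity meets every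
translate of `π ℤ` at arbitrarily large times. -/
theorem frequently_eq_add_int_mul_pi {y : ℝ → ℝ} (hy : ContinuousOn y (Ici 0))
    (hlim : Tendsto (fun t => |y t|) atTop atTop) (θ : ℝ) :
    ∃ᶠ t in atTop, ∃ n : ℤ, y t = θ + n * Real.pi := by
  rw [frequently_atTop]
  intro T
  set T' := max T 0
  have hpre : IsPreconnected (y '' Ici T') :=
    isPreconnected_Ici.image y (hy.mono (Ici_subset_Ici.2 (le_max_right _ _)))
  obtain ⟨s, hs, hsT⟩ :=
    ((hlim.eventually_ge_atTop (|y T'| + Real.pi)).and (eventually_ge_atTop T')).exists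
  -- Two attained values at least `π` apart enclose a point of `θ + π ℤ`, which is attained by
  -- connectedness. Below, `y s` lies that far above or below `y T'`.
  have key : ∀ a b : ℝ, a ∈ y '' Ici T' → b ∈ y '' Ici T' → a + Real.pi ≤ b →
      ∃ t ≥ T, ∃ n : ℤ, y t = θ + n * Real.pi := by
    intro a b ha hb hab
    have hpi := Real.pi_pos
    have h1 := Int.le_ceil ((a - θ) / Real.pi)
    have h2 := (Int.ceil_lt_add_one ((a - θ) / Real.pi)).le
    rw [div_le_iff₀ hpi] at h1
    rw [← sub_le_iff_le_add, le_div_iff₀ hpi] at h2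
    obtain ⟨t, ht, hyt⟩ := hpre.Icc_subset ha hb
      (show θ + ⌈(a - θ) / Real.pi⌉ * Real.pi ∈ Icc a b from ⟨by linarith, by linarith⟩)
    exact ⟨t, (le_max_left _ _).trans ht, _, hyt⟩
  have hm0 : y T' ∈ y '' Ici T' := mem_image_of_mem _ self_mem_Ici
  have hms : y s ∈ y '' Ici T' := mem_image_of_mem _ hsT
  rcases le_abs'.1 hs with h | h
  · exact key _ _ hms hm0 (by linarith [neg_abs_le (y T')])
  · exact key _ _ hm0 hms (by linarith [le_abs_self (y T')])

/-- Along a curve tending to infinity the only possible finite limit of `exp (-z) / z` is `0`. -/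
theorem eq_zero_of_tendsto_exp_neg_div {γ : ℝ → ℂ} (hγ : ContinuousOn γ (Ici 0))
    (hinf : Tendsto γ atTop (cocompact ℂ)) {k : ℂ}
    (hk : Tendsto (fun t => Complex.exp (-γ t) / γ t) atTop (𝓝 k)) : k = 0 := by
  by_contra hk0
  have hnorm : Tendsto (fun t => ‖γ t‖) atTop atTop := tendsto_norm_cocompact_atTop.comp hinf
  have hpos : ∀ᶠ t in atTop, 0 < ‖γ t‖ := hnorm.eventually_gt_atTop 0
  have hexp_norm : ∀ t, ‖Complex.exp (-γ t)‖ = Real.exp (-(γ t).re) := fun t => by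
    rw [Complex.norm_exp, Complex.neg_re]
  have hratio : Tendsto (fun t => Real.exp (-(γ t).re) / ‖γ t‖) atTop (𝓝 ‖k‖) :=
    hk.norm.congr fun t => by rw [norm_div, hexp_norm]
  have hexp : Tendsto (fun t => Real.exp (-(γ t).re)) atTop atTop := by
    refine (hratio.pos_mul_atTop (norm_pos_iff.2 hk0) hnorm).congr' ?_
    filter_upwards [hpos] with t ht using div_mul_cancel₀ _ ht.ne'
  have hre : Tendsto (fun t => -(γ t).re) atTop atTop := Real.tendsto_exp_comp_atTop.1 hexp
  -- `Re γ` is only logarithmic in `‖γ‖`, so the curve goes to infinity in a vertical direction.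
  have hre0 : Tendsto (fun t => (γ t).re / ‖γ t‖) atTop (𝓝 0) := by
    have h1 : Tendsto (fun x : ℝ => x / Real.exp x) atTop (𝓝 0) := by
      simpa using Real.tendsto_pow_mul_exp_neg_atTop_nhds_zero 1 |>.congr fun x => by
        rw [Real.exp_neg, pow_one, div_eq_mul_inv]
    have h2 := ((h1.comp hre).mul hratio).neg
    rw [zero_mul, neg_zero] at h2
    refine h2.congr fun t => ?_
    have := Real.exp_ne_zero (-(γ t).re)
    simp only [Function.comp_apply]
    field_simp
  have him1 : Tendsto (fun t => |(γ t).im| / ‖γ t‖) atTop (𝓝 1) := by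
    have h1 : Tendsto (fun t => √(1 - ((γ t).re / ‖γ t‖) ^ 2)) atTop (𝓝 (√(1 - 0 ^ 2))) :=
      ((hre0.pow 2).const_sub 1).sqrt
    rw [show √(1 - 0 ^ 2 : ℝ) = 1 by norm_num] at h1
    refine h1.congr' ?_
    filter_upwards [hpos] with t ht
    have h2 : ‖γ t‖ ^ 2 = (γ t).re ^ 2 + (γ t).im ^ 2 := by
      rw [Complex.sq_norm, Complex.normSq_apply]; ring
    have h3 : 1 - ((γ t).re / ‖γ t‖) ^ 2 = (|(γ t).im| / ‖γ t‖) ^ 2 := by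
      rw [div_pow, div_pow, sq_abs]
      field_simp
      linarith
    rw [h3, Real.sqrt_sq (by positivity)]
  have himabs : Tendsto (fun t => |(γ t).im|) atTop atTop := by
    refine (him1.pos_mul_atTop one_pos hnorm).congr' ?_
    filter_upwards [hpos] with t ht using div_mul_cancel₀ _ ht.ne'
  have hreim : Tendsto (fun t => (γ t).re / (γ t).im) atTop (𝓝 0) := by
    rw [tendsto_zero_iff_abs_tendsto_zero]
    have h1 := hre0.abs.div him1 one_ne_zero
    rw [abs_zero, zero_div] at h1
    refine h1.congr' ?_
    filter_upwards [hpos] with t ht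
    simp only [Function.comp_apply, abs_div, abs_norm]
    exact div_div_div_cancel_right₀ ht.ne' _ _
  have hdir : Tendsto (fun t => γ t / ((γ t).im : ℂ)) atTop (𝓝 Complex.I) := by
    have h1 : Tendsto (fun t => (((γ t).re / (γ t).im : ℝ) : ℂ) + Complex.I) atTop
        (𝓝 (((0 : ℝ) : ℂ) + Complex.I)) :=
      ((Complex.continuous_ofReal.tendsto 0).comp hreim).add_const _
    rw [Complex.ofReal_zero, zero_add] at h1
    refine h1.congr' ?_
    filter_upwards [himabs.eventually_gt_atTop 0] with t ht
    have ht' : ((γ t).im : ℂ) ≠ 0 := by exact_mod_cast abs_pos.1 ht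
    nth_rewrite 3 [← Complex.re_add_im (γ t)]
    push_cast
    field_simp
  -- The denominator is now real, so the phase of the quotient is that of `exp (-γ)` up to sign: it
  -- is imaginary when `Im γ ∈ π/2 + π ℤ` and real when `Im γ ∈ π ℤ`. Both occur at arbitrarily late
  -- times, so both parts of the limit vanish.
  have hlim : Tendsto (fun t => Complex.exp (-γ t) / ((γ t).im : ℂ)) atTop (𝓝 (k * Complex.I)) := by
    refine (hk.mul hdir).congr' ?_
    filter_upwards [hpos] with t ht
    exact div_mul_div_cancel₀ (norm_pos_iff.1 ht)
  have himc : ContinuousOn (fun t => (γ t).im) (Ici 0) := Complex.continuous_im.comp_continuousOn hγ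
  have hre_zero : (k * Complex.I).re = 0 := by
    have h1 := (Complex.continuous_re.tendsto _).comp hlim
    by_contra hne
    obtain ⟨t, ⟨n, hn⟩, ht⟩ :=
      ((frequently_eq_add_int_mul_pi himc himabs (Real.pi / 2)).and_eventually
      (h1.eventually_ne hne)).exists
    refine ht ?_
    have hcos : Real.cos (γ t).im = 0 := by
      rw [Real.cos_eq_zero_iff]; exact ⟨n, by rw [hn]; ring⟩
    simp [Complex.div_ofReal_re, Complex.exp_re, hcos]
  have him_zero : (k * Complex.I).im = 0 := by
    have h1 := (Complex.continuous_im.tendsto _).comp hlim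
    by_contra hne
    obtain ⟨t, ⟨n, hn⟩, ht⟩ := ((frequently_eq_add_int_mul_pi himc himabs 0).and_eventually
      (h1.eventually_ne hne)).exists
    refine ht ?_
    have hsin : Real.sin (γ t).im = 0 := by
      rw [Real.sin_eq_zero_iff]; exact ⟨n, by rw [hn]; ring⟩
    simp [Complex.div_ofReal_im, Complex.exp_im, hsin]
  exact mul_ne_zero hk0 Complex.I_ne_zero (Complex.ext hre_zero him_zero)

/-- The function `exp z + β z + α`. -/
noncomputable def expAddLinear (α β z : ℂ) : ℂ := Complex.exp z + β * z + α

/-! ### Zeros of `exp z + β z + α` and critical points of its Newton map -/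

section ExpAddLinear

variable {α β c z : ℂ}

theorem hasDerivAt_expAddLinear (α β z : ℂ) :
    HasDerivAt (expAddLinear α β) (Complex.exp z + β) z := by
  have h := ((Complex.hasDerivAt_exp z).add ((hasDerivAt_id z).const_mul β)).add_const α
  rw [mul_one] at h
  exact h

theorem differentiable_expAddLinear (α β : ℂ) : Differentiable ℂ (expAddLinear α β) :=
  fun z => (hasDerivAt_expAddLinear α β z).differentiableAt

theorem deriv_expAddLinear (α β : ℂ) :
    deriv (expAddLinear α β) = fun z => Complex.exp z + β :=
  funext fun z => (hasDerivAt_expAddLinear α β z).deriv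

theorem deriv_deriv_expAddLinear (α β z : ℂ) :
    deriv (deriv (expAddLinear α β)) z = Complex.exp z := by
  rw [deriv_expAddLinear]
  exact ((Complex.hasDerivAt_exp z).add_const β).deriv

theorem eventually_exp_add_ne_zero (β z : ℂ) : ∀ᶠ w in 𝓝[≠] z, Complex.exp w + β ≠ 0 :=
  ((Complex.hasDerivAt_exp z).add_const β).eventually_ne (Complex.exp_ne_zero z)

theorem eventually_expAddLinear_ne_zero (α β z : ℂ) : ∀ᶠ w in 𝓝[≠] z, expAddLinear α β w ≠ 0 := by
  refine (AnalyticAt.eventually_eq_zero_or_eventually_ne_zero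
    ((differentiable_expAddLinear α β).analyticAt z)).resolve_left fun h => ?_
  have h0 : expAddLinear α β =ᶠ[𝓝 z] fun _ => 0 := h
  have h2 := h0.deriv.deriv.eq_of_nhds
  rw [deriv_deriv_expAddLinear] at h2
  simp at h2

/-- The derivative at the simple zeros is bounded below uniformly. -/
theorem exists_lower_bound_deriv_at_zeros (α : ℂ) (hβ : β ≠ 0) :
    ∃ δ > 0, ∀ c, expAddLinear α β c = 0 → Complex.exp c + β ≠ 0 →
      δ * (1 + ‖Complex.exp c‖) ≤ ‖Complex.exp c + β‖ := by
  -- `1 - α / β` is the only point that can be a common zero of the function and its derivative.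
  obtain ⟨ε, hε, hball⟩ := Metric.eventually_nhds_iff.1
    (eventually_nhdsWithin_iff.1 (eventually_expAddLinear_ne_zero α β (1 - α / β)))
  have hβ' : 0 < ‖β‖ := norm_pos_iff.2 hβ
  set η := ‖β‖ * ε
  have hη : 0 < η := mul_pos hβ' hε
  -- Combines `η ≤ x` and `‖exp c‖ ≤ x + ‖β‖` for `x = ‖exp c + β‖`.
  refine ⟨η / (η + ‖β‖ + 1), by positivity, fun c hc hc' => ?_⟩
  have heq : Complex.exp c + β = β * ((1 - α / β) - c) := by
    have : Complex.exp c = -(β * c + α) := by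
      rw [eq_neg_iff_add_eq_zero, ← add_assoc]; exact hc
    rw [this]; field_simp; ring
  have hlow : η ≤ ‖Complex.exp c + β‖ := by
    rw [heq, norm_mul, ← dist_eq_norm, dist_comm]
    refine mul_le_mul_of_nonneg_left ?_ hβ'.le
    by_contra hlt
    refine hball (not_le.1 hlt) ?_ hc
    rintro rfl
    exact hc' (by rw [heq, sub_self, mul_zero])
  have hup : ‖Complex.exp c‖ ≤ ‖Complex.exp c + β‖ + ‖β‖ := by
    simpa using norm_sub_le (Complex.exp c + β) β
  rw [div_mul_eq_mul_div, div_le_iff₀ (by positivity)]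
  nlinarith

theorem hasDerivAt_finitePart_newton_expAddLinear (hz : Complex.exp z + β ≠ 0) :
    HasDerivAt (finitePart (newton (expAddLinear α β)))
      (expAddLinear α β z * Complex.exp z / (Complex.exp z + β) ^ 2) z := by
  have := hasDerivAt_finitePart_newton (z := z) (differentiable_expAddLinear α β)
    (by rwa [deriv_expAddLinear])
  rwa [deriv_deriv_expAddLinear, deriv_expAddLinear] at this

/-- Around a double zero Newton's method is finite, with derivative `1 / 2`. -/
theorem newton_at_double_zero (hz : Complex.exp z + β = 0)
    (hz' : expAddLinear α β z = 0) :
    (∀ᶠ w in 𝓝 z, newton (expAddLinear α β) w ≠ ∞) ∧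
      HasDerivAt (finitePart (newton (expAddLinear α β))) (1 / 2) z := by
  have hfix := newton_of_eq_zero hz'
  refine ⟨?_, ?_⟩
  · have := eventually_nhdsWithin_iff.1 (eventually_exp_add_ne_zero β z)
    filter_upwards [this] with w hw
    by_cases hwz : w = z
    · rw [hwz, hfix]; exact OnePoint.coe_ne_infty z
    · rw [newton_of_deriv_ne_zero (by rw [deriv_expAddLinear]; exact hw hwz)]
      exact OnePoint.coe_ne_infty _
  · rw [hasDerivAt_iff_tendsto_slope]
    have hshift : Tendsto (fun w => w - z) (𝓝[≠] z) (𝓝[≠] 0) := by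
      refine tendsto_nhdsWithin_iff.2 ⟨?_, ?_⟩
      · have : Tendsto (fun w => w - z) (𝓝 z) (𝓝 (z - z)) := (continuous_sub_right z).tendsto z
        rw [sub_self] at this
        exact this.mono_left nhdsWithin_le_nhds
      · filter_upwards [self_mem_nhdsWithin] with w hw using sub_ne_zero.2 hw
    have hlim := ((tendsto_exp_sub_one_sub_id_div_sq.comp hshift).div
      (tendsto_exp_sub_one_div_id.comp hshift) one_ne_zero).const_sub 1
    rw [show (1 : ℂ) - 1 / 2 / 1 = 1 / 2 by norm_num] at hlim
    refine hlim.congr' ?_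
    filter_upwards [self_mem_nhdsWithin, eventually_exp_add_ne_zero β z] with w hw hw'
    have hwz : w - z ≠ 0 := sub_ne_zero.2 hw
    have hexp : Complex.exp w = -β * Complex.exp (w - z) := by
      rw [← eq_neg_of_add_eq_zero_left hz, ← Complex.exp_add]; congr 1; ring
    have hα : α = β - β * z := by
      have : Complex.exp z + β * z + α = 0 := hz'
      linear_combination this - hz
    have h1 : Complex.exp (w - z) - 1 ≠ 0 := fun h0 =>
      hw' (by rw [hexp]; linear_combination (-β) * h0)
    rw [slope_def_field, finitePart_of_eq hfix, finitePart_of_eq (newton_of_deriv_ne_zero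
      (by rw [deriv_expAddLinear]; exact hw'))]
    -- With `exp z = -β` and `α = β - β z`, both numerator and denominator carry the factor `-β`,
    -- and only `t = w - z` remains.
    have hq : expAddLinear α β w / deriv (expAddLinear α β) w
        = (Complex.exp (w - z) - 1 - (w - z)) / (Complex.exp (w - z) - 1) := by
      rw [deriv_expAddLinear, div_eq_div_iff hw' h1, expAddLinear, hexp, hα]
      ring
    rw [hq]
    simp only [Function.comp_apply, Pi.div_apply]
    field_simp
    ring

theorem simple_zero_of_hasDerivAt_zero
    (hfin : newton (expAddLinear α β) z ≠ ∞)
    (hd : HasDerivAt (finitePart (newton (expAddLinear α β))) 0 z) :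
    expAddLinear α β z = 0 ∧ Complex.exp z + β ≠ 0 := by
  by_cases h1 : Complex.exp z + β = 0
  · by_cases h2 : expAddLinear α β z = 0
    · have := hd.unique (newton_at_double_zero h1 h2).2
      norm_num at this
    · exact absurd (newton_of_pole (by rw [deriv_expAddLinear]; exact h1) h2) hfin
  · have := hd.unique (hasDerivAt_finitePart_newton_expAddLinear (α := α) h1)
    refine ⟨?_, h1⟩
    simpa [h1, Complex.exp_ne_zero] using this.symm

/-! ### Meromorphy, essential singularity and asymptotic values -/

theorem continuous_newton_expAddLinear (α β : ℂ) :
    Continuous (newton (expAddLinear α β)) := by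
  refine continuous_iff_continuousAt.2 fun z => ?_
  by_cases h1 : Complex.exp z + β = 0
  · by_cases h2 : expAddLinear α β z = 0
    · obtain ⟨hfin, hd⟩ := newton_at_double_zero h1 h2
      refine (OnePoint.continuous_coe.continuousAt.comp hd.continuousAt).congr ?_
      filter_upwards [hfin] with w hw using coe_finitePart hw
    · refine continuousAt_newton_of_pole (differentiable_expAddLinear α β)
        (by rw [deriv_expAddLinear]; exact h1) h2 ?_
      rw [deriv_expAddLinear]
      exact eventually_exp_add_ne_zero β z
  · exact continuousAt_newton (differentiable_expAddLinear α β) (by rwa [deriv_expAddLinear])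

theorem meromorphicAt_finitePart_newton (α β z : ℂ) :
    MeromorphicAt (finitePart (newton (expAddLinear α β))) z := by
  have hh := differentiable_expAddLinear α β
  have h1 : MeromorphicAt (fun w => w - expAddLinear α β w / deriv (expAddLinear α β) w) z :=
    (MeromorphicAt.id z).sub
      ((hh.analyticAt z).meromorphicAt.div (hh.deriv.analyticAt z).meromorphicAt)
  refine h1.congr ?_
  filter_upwards [eventually_exp_add_ne_zero β z] with w hw
  exact (finitePart_of_eq (newton_of_deriv_ne_zero (by rwa [deriv_expAddLinear]))).symm

/-- Clearing the denominator keeps the formula valid at a double zero, where both sides are `0`. It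
expresses `exp (-z)` through `z` and the value of the map. -/
theorem finitePart_newton_sub_mul (hβ : β ≠ 0) (hz : newton (expAddLinear α β) z ≠ ∞) :
    (finitePart (newton (expAddLinear α β)) z - -α / β) * (1 + β * Complex.exp (-z))
      = z - 1 - -α / β := by
  have hE := Complex.exp_ne_zero z
  by_cases h1 : Complex.exp z + β = 0
  · by_cases h2 : expAddLinear α β z = 0
    · have h3 : Complex.exp z + β * z + α = 0 := h2
      have h4 : 1 + β * Complex.exp (-z) = 0 := by
        rw [Complex.exp_neg]; field_simp; rw [h1, mul_zero]
      rw [h4, mul_zero]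
      field_simp
      linear_combination h1 - h3
    · exact absurd (newton_of_pole (by rw [deriv_expAddLinear]; exact h1) h2) hz
  · rw [finitePart_of_eq (newton_of_deriv_ne_zero (by rwa [deriv_expAddLinear])),
      deriv_expAddLinear, expAddLinear, Complex.exp_neg]
    field_simp
    ring

theorem tendsto_newton_left (α : ℂ) (hβ : β ≠ 0) :
    Tendsto (fun t : ℝ => newton (expAddLinear α β) ((-t : ℝ) : ℂ)) atTop
      (𝓝 ((-α / β : ℂ) : OnePoint ℂ)) := by
  have hexp : Tendsto (fun t : ℝ => Complex.exp ((-t : ℝ) : ℂ)) atTop (𝓝 0) := by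
    rw [tendsto_zero_iff_norm_tendsto_zero]
    refine Real.tendsto_exp_neg_atTop_nhds_zero.congr fun t => ?_
    rw [Complex.norm_exp, Complex.ofReal_re]
  have hmul : Tendsto (fun t : ℝ => ((-t : ℝ) : ℂ) * Complex.exp ((-t : ℝ) : ℂ)) atTop (𝓝 0) := by
    rw [tendsto_zero_iff_norm_tendsto_zero]
    have h0 := (Real.tendsto_pow_mul_exp_neg_atTop_nhds_zero 1).abs
    rw [abs_zero] at h0
    refine h0.congr fun t => ?_
    rw [norm_mul, Complex.norm_exp, Complex.ofReal_re, Complex.norm_real, Real.norm_eq_abs,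
      abs_neg, pow_one, abs_mul, Real.abs_exp]
  have hden : Tendsto (fun t : ℝ => Complex.exp ((-t : ℝ) : ℂ) + β) atTop (𝓝 β) := by
    simpa using hexp.add_const β
  have hlim := ((hmul.sub hexp).sub_const α).div hden hβ
  rw [sub_zero, zero_sub] at hlim
  refine ((OnePoint.continuous_coe.tendsto _).comp hlim).congr' ?_
  filter_upwards [hden.eventually_ne hβ] with t ht
  rw [newton_of_deriv_ne_zero (by rwa [deriv_expAddLinear])]
  simp only [Function.comp_apply, Pi.div_apply, deriv_expAddLinear, expAddLinear]
  congr 1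
  field_simp
  ring

theorem not_tendsto_newton_right (hβ : β ≠ 0) (a : ℂ) :
    ¬ Tendsto (fun t : ℝ => newton (expAddLinear α β) (t : ℂ)) atTop (𝓝 (a : OnePoint ℂ)) := by
  intro h
  obtain ⟨hfin, hp⟩ := tendsto_finitePart h
  have hexp : Tendsto (fun t : ℝ => Complex.exp (-(t : ℂ))) atTop (𝓝 0) := by
    rw [tendsto_zero_iff_norm_tendsto_zero]
    refine Real.tendsto_exp_neg_atTop_nhds_zero.congr fun t => ?_
    rw [Complex.norm_exp, Complex.neg_re, Complex.ofReal_re]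
  have hlim := ((hp.sub_const (-α / β)).mul ((hexp.const_mul β).const_add 1)).add_const (1 + -α / β)
  have hlim' : Tendsto (fun t : ℝ => (t : ℂ)) atTop
      (𝓝 ((a - -α / β) * (1 + β * 0) + (1 + -α / β))) := by
    refine hlim.congr' ?_
    filter_upwards [hfin] with t ht
    rw [finitePart_newton_sub_mul hβ ht]
    ring
  refine not_tendsto_nhds_of_tendsto_atTop tendsto_abs_atTop_atTop _
    (hlim'.norm.congr fun t => ?_)
  rw [Complex.norm_real, Real.norm_eq_abs]

theorem isTranscendentalMeromorphic_newton (α : ℂ) (hβ : β ≠ 0) :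
    IsTranscendentalMeromorphic (newton (expAddLinear α β)) where
  continuous := continuous_newton_expAddLinear α β
  meromorphic := meromorphicAt_finitePart_newton α β
  essential := by
    rintro ⟨l, hl⟩
    have hco : ∀ g : ℝ → ℝ, Tendsto (fun t => |g t|) atTop atTop →
        Tendsto (fun t => (g t : ℂ)) atTop (cocompact ℂ) := fun g hg => by
      rw [← Metric.cobounded_eq_cocompact, ← tendsto_norm_atTop_iff_cobounded]
      simpa using hg
    have h1 := hl.comp (hco (fun t => -t) (by simpa using tendsto_abs_atTop_atTop))
    have h2 := hl.comp (hco (fun t => t) tendsto_abs_atTop_atTop)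
    rw [tendsto_nhds_unique h1 (tendsto_newton_left α hβ)] at h2
    exact not_tendsto_newton_right hβ _ h2

/-- The only possible finite asymptotic value is `-α / β`. -/
theorem IsAsymptoticValue.eq_of_newton (hβ : β ≠ 0) {a : ℂ}
    (ha : IsAsymptoticValue (newton (expAddLinear α β)) a) : a = -α / β := by
  obtain ⟨γ, hγ, hinf, hlim⟩ := ha
  obtain ⟨hfin, hp⟩ := tendsto_finitePart hlim
  by_contra hne
  have hb : a - -α / β ≠ 0 := sub_ne_zero.2 hne
  have hb' := (hp.sub_const (-α / β)).eventually_ne hb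
  have hnorm : Tendsto (fun t => ‖γ t‖) atTop atTop := tendsto_norm_cocompact_atTop.comp hinf
  have hinv : Tendsto (fun t => (γ t)⁻¹) atTop (𝓝 0) := by
    rw [← Metric.cobounded_eq_cocompact] at hinf
    exact tendsto_inv₀_cobounded.comp hinf
  -- Solving the identity for `exp (-γ) / γ` gives this expression, whose limit `1 / (β (a - u))` is
  -- nonzero, with `u = -α / β`.
  have hk := ((((hinv.const_mul (1 + -α / β)).const_sub 1).div
    (hp.sub_const (-α / β)) hb).sub hinv).div_const β
  have hk' := eq_zero_of_tendsto_exp_neg_div hγ hinf (hk.congr' ?_)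
  · simp [hβ, hb] at hk'
  · filter_upwards [hfin, hb', hnorm.eventually_gt_atTop 0] with t ht htb ht0
    have hγ0 : γ t ≠ 0 := norm_pos_iff.1 ht0
    have heq := finitePart_newton_sub_mul hβ ht
    simp only [Pi.div_apply]
    generalize finitePart (newton (expAddLinear α β)) (γ t) - -α / β = p at *
    generalize -α / β = u at *
    field_simp
    linear_combination -heq

/-! ### Uniform contraction and the postsingular set -/

/-- A common radius for the discs around the simple zeros on which Newton's method contracts. -/
theorem exists_radius_of_lower_bound {δ : ℝ} (hδ : 0 < δ) (α β : ℂ) :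
    ∃ r : ℝ, 0 < r ∧ ∀ c : ℂ, expAddLinear α β c = 0 →
      δ * (1 + ‖Complex.exp c‖) ≤ ‖Complex.exp c + β‖ →
      ∀ z ∈ Metric.ball c r, newton (expAddLinear α β) z ≠ ∞ ∧
        ∃ d : ℂ, HasDerivAt (finitePart (newton (expAddLinear α β))) d z ∧ ‖d‖ ≤ 1 / 2 := by
  -- The bound `1` gives `‖exp w - 1‖ ≤ 2 r`; `δ / 4` costs at most half of the lower bound on the
  -- derivative; the last term makes the final quotient at most `1 / 2`.
  set r := min 1 (min (δ / 4) (δ ^ 2 / (24 * (2 + ‖β‖))))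
  have hr1 : r ≤ 1 := min_le_left _ _
  have hr2 : r ≤ δ / 4 := (min_le_right _ _).trans (min_le_left _ _)
  have hr3 : r ≤ δ ^ 2 / (24 * (2 + ‖β‖)) := (min_le_right _ _).trans (min_le_right _ _)
  have hr0 : 0 < r := by positivity
  refine ⟨r, hr0, fun c hc hlow z hz => ?_⟩
  rw [mem_ball_iff_norm] at hz
  set E := Complex.exp c
  set w := z - c
  have hE : 0 ≤ ‖E‖ := norm_nonneg _
  have hz_exp : Complex.exp z = E * Complex.exp w := by
    rw [← Complex.exp_add]; congr 1; simp [w]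
  have hexp : ‖Complex.exp w - 1‖ ≤ 2 * r :=
    (Complex.norm_exp_sub_one_le (hz.le.trans hr1)).trans (by linarith)
  have hexp' : ‖Complex.exp w‖ ≤ 3 := by
    have : ‖Complex.exp w‖ ≤ ‖Complex.exp w - 1‖ + ‖(1 : ℂ)‖ := by
      simpa using norm_add_le (Complex.exp w - 1) 1
    rw [norm_one] at this
    linarith
  have hmul : ‖E * (Complex.exp w - 1)‖ ≤ ‖E‖ * (2 * r) := by
    rw [norm_mul]; exact mul_le_mul_of_nonneg_left hexp hE
  have hden : δ / 2 * (1 + ‖E‖) ≤ ‖Complex.exp z + β‖ := by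
    have h1 : ‖E + β‖ ≤ ‖Complex.exp z + β‖ + ‖E * (Complex.exp w - 1)‖ := by
      have h2 := norm_sub_le (Complex.exp z + β) (E * (Complex.exp w - 1))
      rwa [show Complex.exp z + β - E * (Complex.exp w - 1) = E + β by rw [hz_exp]; ring] at h2
    have h3 : ‖E‖ * (2 * r) ≤ ‖E‖ * (δ / 2) := mul_le_mul_of_nonneg_left (by linarith) hE
    nlinarith
  have hden0 : 0 < ‖Complex.exp z + β‖ := lt_of_lt_of_le (by positivity) hden
  have hnum : ‖expAddLinear α β z‖ ≤ r * (2 + ‖β‖) * (1 + ‖E‖) := by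
    have hc' : E + β * c + α = 0 := hc
    have h1 : expAddLinear α β z = E * (Complex.exp w - 1) + β * w := by
      rw [expAddLinear, hz_exp]
      simp only [w]
      linear_combination hc'
    have h2 : ‖β * w‖ ≤ ‖β‖ * r := by
      rw [norm_mul]; exact mul_le_mul_of_nonneg_left hz.le (norm_nonneg _)
    rw [h1]
    refine (norm_add_le _ _).trans ((add_le_add hmul h2).trans ?_)
    have : 0 ≤ r * ‖β‖ * ‖E‖ := by positivity
    nlinarith
  have hnum' : ‖Complex.exp z‖ ≤ 3 * (1 + ‖E‖) := by
    rw [hz_exp, norm_mul]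
    nlinarith [mul_le_mul_of_nonneg_left hexp' hE]
  have hne : Complex.exp z + β ≠ 0 := norm_pos_iff.1 hden0
  refine ⟨?_, _, hasDerivAt_finitePart_newton_expAddLinear hne, ?_⟩
  · rw [newton_of_deriv_ne_zero (by rwa [deriv_expAddLinear])]
    exact OnePoint.coe_ne_infty _
  · rw [norm_div, norm_mul, norm_pow, div_le_iff₀ (by positivity)]
    rw [le_div_iff₀ (by positivity)] at hr3
    calc ‖expAddLinear α β z‖ * ‖Complex.exp z‖
        ≤ (r * (2 + ‖β‖) * (1 + ‖E‖)) * (3 * (1 + ‖E‖)) := by gcongr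
      _ = r * (24 * (2 + ‖β‖)) * ((1 + ‖E‖) ^ 2 / 8) := by ring
      _ ≤ δ ^ 2 * ((1 + ‖E‖) ^ 2 / 8) := by gcongr
      _ = 1 / 2 * (δ / 2 * (1 + ‖E‖)) ^ 2 := by ring
      _ ≤ 1 / 2 * ‖Complex.exp z + β‖ ^ 2 := by gcongr

theorem setDist_pos_of_ball_subset_fatouSet {f : ℂ → OnePoint ℂ} {A : Set ℂ} {r : ℝ} (hr : 0 < r)
    (h : ∀ c ∈ A, ∀ z ∈ Metric.ball c r, (z : OnePoint ℂ) ∈ fatouSet f) :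
    0 < setDist A (finiteJuliaSet f) := by
  refine (ENNReal.ofReal_pos.2 hr).trans_le
    (le_iInf₂ fun c hc => le_iInf₂ fun w hw => ?_)
  rw [edist_dist]
  refine ENNReal.ofReal_le_ofReal (not_lt.1 fun hlt => hw (h c hc w ?_))
  rwa [Metric.mem_ball, dist_comm]

/-- Taking the closure of the singular values adds nothing outside the right-hand side: the zeros
satisfying the non-strict bound form a closed set, and each is its own orbit. -/
theorem postsingularSet_newton_subset (hβ : β ≠ 0) {δ : ℝ}
    (hlow : ∀ c, expAddLinear α β c = 0 → Complex.exp c + β ≠ 0 →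
      δ * (1 + ‖Complex.exp c‖) ≤ ‖Complex.exp c + β‖) :
    postsingularSet (newton (expAddLinear α β)) ⊆
      orbit (newton (expAddLinear α β)) (-α / β) ∪
        {c | expAddLinear α β c = 0 ∧ δ * (1 + ‖Complex.exp c‖) ≤ ‖Complex.exp c + β‖} := by
  set T := {c | expAddLinear α β c = 0 ∧ δ * (1 + ‖Complex.exp c‖) ≤ ‖Complex.exp c + β‖}
  have hT : IsClosed T := by
    have hc := (differentiable_expAddLinear α β).continuous
    have hle : IsClosed {c : ℂ | δ * (1 + ‖Complex.exp c‖) ≤ ‖Complex.exp c + β‖} :=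
      isClosed_le (by fun_prop) (by fun_prop)
    exact (isClosed_eq hc continuous_const).inter hle
  have hS : closure (singularValues (newton (expAddLinear α β))) ⊆ {-α / β} ∪ T := by
    refine closure_minimal ?_ (isClosed_singleton.union hT)
    rintro a (⟨z, hz, hd⟩ | ha)
    · obtain ⟨h1, h2⟩ :=
        simple_zero_of_hasDerivAt_zero (by rw [hz]; exact OnePoint.coe_ne_infty a) hd
      rw [newton_of_eq_zero h1, OnePoint.coe_eq_coe] at hz
      rw [← hz]
      exact Or.inr ⟨h1, hlow z h1 h2⟩
    · exact Or.inl (ha.eq_of_newton hβ)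
  refine iUnion₂_subset fun s hs => ?_
  rcases hS hs with hs | hs
  · rw [mem_singleton_iff.1 hs]; exact subset_union_left
  · rw [orbit_of_fixed (newton_of_eq_zero hs.1), singleton_subset_iff]
    exact Or.inr hs

end ExpAddLinear

end MeroDyn

theorem mainTheorem9 (α β : ℂ) (hβ : β ≠ 0) (N : ℂ → OnePoint ℂ)
    (hN : N = MeroDyn.newton (fun z => Complex.exp z + β * z + α)) :
    (0 < MeroDyn.setDist (MeroDyn.orbit N (-α / β)) (MeroDyn.finiteJuliaSet N) →
      MeroDyn.IsTopologicallyHyperbolic N) ∧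
    ∃ r : ℝ, 0 < r ∧ ∀ c : ℂ, MeroDyn.IsSuperattractingFixedPoint N c →
      ∀ z ∈ Metric.ball c r, N z ≠ OnePoint.infty ∧
        ∃ d : ℂ, HasDerivAt (MeroDyn.finitePart N) d z ∧ ‖d‖ < 1 := by
  obtain rfl : N = MeroDyn.newton (MeroDyn.expAddLinear α β) := hN
  obtain ⟨δ, hδ, hlow⟩ := MeroDyn.exists_lower_bound_deriv_at_zeros α hβ
  obtain ⟨r, hr, hball⟩ := MeroDyn.exists_radius_of_lower_bound hδ α β
  refine ⟨fun hu => ⟨MeroDyn.isTranscendentalMeromorphic_newton α hβ, ?_⟩, r, hr, ?_⟩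
  · refine lt_of_lt_of_le ?_
      (MeroDyn.setDist_anti_left (MeroDyn.postsingularSet_newton_subset hβ hlow))
    rw [MeroDyn.setDist_union_left, lt_min_iff]
    refine ⟨hu, MeroDyn.setDist_pos_of_ball_subset_fatouSet hr fun c hc z hz => ?_⟩
    exact MeroDyn.mem_fatouSet_of_contracting (MeroDyn.newton_of_eq_zero hc.1)
      (hball c hc.1 hc.2) hz
  · rintro c ⟨hfix, hd⟩ z hz
    obtain ⟨h1, h2⟩ := MeroDyn.simple_zero_of_hasDerivAt_zero
      (by rw [hfix]; exact OnePoint.coe_ne_infty c) hd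
    obtain ⟨hfin, d, hd, hd2⟩ := hball c h1 (hlow c h1 h2) z hz
    exact ⟨hfin, d, hd, hd2.trans_lt (by norm_num)⟩
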